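/- **Mayer–Vietoris theorem for involutive manifolds.** Let $X$ be a smooth finite-dimensional manifold (Hausdorff and second countable; a boundary or corners are allowed) and let $\tau\colon X\to X$ be a smooth map with $\tau^2=\mathrm{id}_X$. For such a pair $(X,\tau)$ and a sign $\pm$ let $\Omega^p_\pm(X)=\{\omega\in\Omega^p(X)\mid \tau^*\omega=\pm\omega\}$, a complex under the exterior derivative $\mathrm d$, and let $$\mathrm H^p_{\mathrm{dR}\,\pm}(X)=\ker\big(\mathrm d\colon\Omega^p_\pm(X)\to\Omega^{p+1}_\pm(X)\big)\big/\mathrm d\,\Omega^{p-1}_\pm(X)\qquad(p\ge 0,\ \Omega^{-1}_\pm=0)$$ be the equivariant ($+$) and the Real ($-$) de Rham cohomology groups. Let $V\subset X$ be an open subset with $X=V\cup\tau(V)$, put $U=V\cap\tau(V)$ with the restricted involution, and let $\imath\colon V\hookrightarrow X$ and $\jmath\colon U\hookrightarrow V$ be the inclusions. Then, for either choice of the sign $\pm$ (with $\mp$ the opposite sign): 1. There is a smooth function $f\colon X\to[0,\infty)$ such that $(f,\tau^*f)$ is a partition of unity subordinate to the cover $(V,\tau(V))$: $\operatorname{supp}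 f\subset V$, $\operatorname{supp}(\tau^*f)\subset\tau(V)$ and $f+\tau^*f=1$. 2. For every $p\ge 0$ the sequence $$0\longrightarrow\Omega^p_\mp(X)\xrightarrow{\ \imath^*\ }\Omega^p(V)\xrightarrow{\ (1\pm\tau^*)\jmath^*\ }\Omega^p_\pm(U)\longrightarrow 0$$ is exact, and its maps commute with $\mathrm d$. Moreover, for every $f$ as in 1 and every $\rho\in\Omega^p_\pm(U)$, the form on $V$ that equals $(\tau^*f)\,\rho$ on $U$ and $0$ on $V\setminus U$ is smooth and is mapped to $\rho$ by $(1\pm\tau^*)\jmath^*$. 3. There are linear maps $\Delta^p\colon \mathrm H^p_{\mathrm{dR}\,\pm}(U)\to\mathrm H^{p+1}_{\mathrm{dR}\,\mp}(X)$, $p\ge 0$, such that the sequence $$0\to \mathrm H^0_{\mathrm{dR}\,\mp}(X)\to\cdots\to\mathrm H^{p-1}_{\mathrm{dR}\,\mp}(X)\xrightarrow{\imath^*}\mathrm H^{p-1}_{\mathrm{dR}}(V)\xrightarrow{(1\pm\tau^*)\jmath^*}\mathrm H^{p-1}_{\mathrm{dR}\,\pm}(U)\xrightarrow{\Delta^{p-1}}\mathrm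 H^p_{\mathrm{dR}\,\mp}(X)\xrightarrow{\imath^*}\mathrm H^p_{\mathrm{dR}}(V)\to\cdots$$ is exact. They are the connecting maps of the short exact sequence in 2: if $\rho\in\Omega^p_\pm(U)$ and $\omega\in\Omega^{p+1}_\mp(X)$ are closed and $\eta\in\Omega^p(V)$ satisfies $(1\pm\tau^*)\jmath^*\eta=\rho$ and $\imath^*\omega=\mathrm d\eta$, then $\Delta^p[\rho]=[\omega]$. -/

import Mathlib

open Set Filter TopologicalSpace
open scoped Manifold ContDiff Topology

noncomputable section

namespace InvolutiveDeRham

section Forms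

variable {E : Type*} [NormedAddCommGroup E] [NormedSpace ℝ E]
  {H : Type*} [TopologicalSpace H] {I : ModelWithCorners ℝ E H}
  {M : Type*} [TopologicalSpace M] [ChartedSpace H M]
  {N : Type*} [TopologicalSpace N] [ChartedSpace H N]

/-! ### Differential forms on manifolds -/

variable (I M) in
/-- Not necessarily continuous real `p`-forms on `M`: families of alternating `p`-linear forms on
the tangent spaces. -/
abbrev FormField (p : ℕ) : Type _ := ∀ x : M, TangentSpace I x [⋀^Fin p]→L[ℝ] ℝ

/-- The coordinate expression of a form in the chart `φ` around `x₀`, i.e. `(φ⁻¹)^* α`. It is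
meaningful on the target of the chart. -/
def inChart {p : ℕ} (α : FormField I M p) (x₀ : M) (y : E) : E [⋀^Fin p]→L[ℝ] ℝ :=
  (α ((extChartAt I x₀).symm y)).compContinuousLinearMap
    (mfderivWithin 𝓘(ℝ, E) I (extChartAt I x₀).symm (range I) y)

/-- A form is smooth if its coordinate expressions are smooth. -/
def IsSmooth {p : ℕ} (α : FormField I M p) : Prop :=
  ∀ x₀ : M, ContDiffOn ℝ ∞ (inChart α x₀) (extChartAt I x₀).target

variable (I M) in
/-- The smooth `p`-forms on `M`, as a subspace of the space of all `p`-forms. -/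
def smoothForms (p : ℕ) : Submodule ℝ (FormField I M p) where
  carrier := {α | IsSmooth α}
  zero_mem' := fun _ ↦ contDiffOn_const (c := 0)
  add_mem' := fun ha hb x₀ ↦ (ha x₀).add (hb x₀)
  smul_mem' := fun c _ ha x₀ ↦ (ha x₀).const_smul c

variable (I M) in
/-- The real vector space `Ω^p(M)` of smooth `p`-forms on `M`. -/
def DForm (p : ℕ) : Type _ := smoothForms I M p

instance (p : ℕ) : AddCommGroup (DForm I M p) := inferInstanceAs (AddCommGroup (smoothForms I M p))

instance (p : ℕ) : Module ℝ (DForm I M p) := inferInstanceAs (Module ℝ (smoothForms I M p))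

/-- The exterior derivative `φ^* d((φ⁻¹)^* α)`, computed at each point `x` in the preferred
chart `φ` at `x`. (`inChart_extD` below: any other chart gives the same.) -/
def extD {p : ℕ} (α : FormField I M p) : FormField I M (p + 1) := fun x ↦
  (extDerivWithin (inChart α x) (range I) (extChartAt I x x)).compContinuousLinearMap
    (mfderiv I 𝓘(ℝ, E) (extChartAt I x) x)

/-- The pullback `f^* α` of a form. -/
def pull {p : ℕ} (f : N → M) (α : FormField I M p) : FormField I N p := fun x ↦
  (α (f x)).compContinuousLinearMap (mfderiv I I f x)

theorem FormField.apply_congr {p : ℕ} (α : FormField I M p) {a b : M} (h : a = b) {v w : Fin p → E}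
    (hv : v = w) : α a v = α b w := by
  subst h hv; rfl

theorem two_le_infty : (2 : WithTop ℕ∞) ≤ ∞ := WithTop.coe_le_coe.2 le_top

theorem IsSmooth.contDiffWithinAt {p : ℕ} {α : FormField I M p} (h : IsSmooth α) (x₀ : M) {y : E}
    (hy : y ∈ (extChartAt I x₀).target) : ContDiffWithinAt ℝ ∞ (inChart α x₀) (range I) y :=
  (h x₀ y hy).mono_of_mem_nhdsWithin (extChartAt_target_mem_nhdsWithin_of_mem hy)

theorem mapsTo_transition {f : N → M} (x₀ : N) (x₁ : M) :
    MapsTo (extChartAt I x₁ ∘ f ∘ (extChartAt I x₀).symm) (range I) (range I) := by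
  intro z _
  simp

theorem pull_id {p : ℕ} (α : FormField I M p) : pull id α = α := by
  funext x
  ext v
  simp [pull, mfderiv_id]

theorem pull_comp {P : Type*} [TopologicalSpace P] [ChartedSpace H P] {p : ℕ} {f : N → M}
    {g : P → N} (hf : ContMDiff I I ∞ f) (hg : ContMDiff I I ∞ g) (α : FormField I M p) :
    pull g (pull f α) = pull (f ∘ g) α := by
  funext x
  ext v
  simp only [pull, mfderiv_comp x ((hf _).mdifferentiableAt (by simp))
    ((hg x).mdifferentiableAt (by simp))]
  rfl

theorem contDiffWithinAt_compCLM {p : ℕ} {a : E → E [⋀^Fin p]→L[ℝ] ℝ} {L : E → E →L[ℝ] E}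
    {s : Set E} {y : E} (ha : ContDiffWithinAt ℝ ∞ a s y) (hL : ContDiffWithinAt ℝ ∞ L s y) :
    ContDiffWithinAt ℝ ∞ (fun z ↦ (a z).compContinuousLinearMap (L z)) s y := by
  let A : ContinuousMultilinearMap ℝ (fun _ : Fin p ↦ E) ℝ →ₗ[ℝ] E [⋀^Fin p]→L[ℝ] ℝ :=
    { toFun := ContinuousMultilinearMap.alternatization
      map_add' := map_add _
      map_smul' := by
        intro c f
        ext v
        simp [ContinuousMultilinearMap.alternatization_apply_apply, Finset.mul_sum,
          mul_left_comm, Units.smul_def] }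
  let A' := A.mkContinuous (Fintype.card (Equiv.Perm (Fin p))) (by
    intro f
    refine ContinuousAlternatingMap.opNorm_le_bound _ (by positivity) fun v ↦ ?_
    simp only [A, LinearMap.coe_mk, AddHom.coe_mk,
      ContinuousMultilinearMap.alternatization_apply_apply]
    refine (norm_sum_le _ _).trans ?_
    rw [mul_assoc, ← nsmul_eq_mul, Fintype.card]
    refine Finset.sum_le_card_nsmul _ _ _ fun σ _ ↦ ?_
    have h1 : ‖Equiv.Perm.sign σ • f (v ∘ σ)‖ = ‖f (v ∘ σ)‖ := by
      rcases Int.units_eq_one_or (Equiv.Perm.sign σ) with h | h <;> simp [h, Units.smul_def]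
    rw [h1]
    refine (f.le_opNorm _).trans_eq ?_
    congr 1
    exact Equiv.prod_comp σ fun i ↦ ‖v i‖)
  let T := ContinuousMultilinearMap.compContinuousLinearMapContinuousMultilinear ℝ
    (fun _ : Fin p ↦ E) (fun _ : Fin p ↦ E) ℝ
  have hT : ContDiff ℝ ∞ fun L : Fin p → E →L[ℝ] E ↦ T L := by
    apply ContinuousMultilinearMap.contDiff
  have key : ∀ z, (a z).compContinuousLinearMap (L z) =
      ((p.factorial : ℝ)⁻¹) • A' (T (fun _ ↦ L z)
        (ContinuousAlternatingMap.toContinuousMultilinearMapCLM ℝ (a z))) := by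
    intro z
    have hf : (p.factorial : ℝ) ≠ 0 := by positivity
    rw [eq_inv_smul_iff₀ hf]
    ext v
    have : ∀ σ : Equiv.Perm (Fin p), Equiv.Perm.sign σ • (a z) (fun i ↦ L z (v (σ i)))
        = (a z) fun i ↦ L z (v i) := by
      intro σ
      have h := (a z).toAlternatingMap.map_perm (fun i ↦ L z (v i)) σ
      simp only [Function.comp_def] at h
      have h' : (a z) (fun i ↦ L z (v (σ i))) = Equiv.Perm.sign σ • (a z) fun i ↦ L z (v i) := h
      rw [h', smul_smul]; simp
    simp [A', A, T, ContinuousMultilinearMap.alternatization_apply_apply, this, Function.comp_def,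
      Fintype.card_perm]
  simp_rw [key]
  refine ContDiffWithinAt.const_smul _ ?_
  refine ContDiff.comp_contDiffWithinAt (g := A') A'.contDiff ?_
  have ha' : ContDiffWithinAt ℝ ∞
      (fun z ↦ ContinuousAlternatingMap.toContinuousMultilinearMapCLM ℝ (a z)) s y :=
    ContDiff.comp_contDiffWithinAt
      (g := ContinuousAlternatingMap.toContinuousMultilinearMapCLM (𝕜 := ℝ) (E := E) (F := ℝ)
        (ι := Fin p) ℝ) (ContinuousLinearMap.contDiff _) ha
  exact ContDiffWithinAt.clm_apply
    (hT.comp_contDiffWithinAt (contDiffWithinAt_pi.2 fun _ ↦ hL)) ha'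

variable [IsManifold I ∞ M] [IsManifold I ∞ N]

theorem contDiffWithinAt_transition {f : N → M} (hf : ContMDiff I I ∞ f) (x₀ : N) (x₁ : M) {y : E}
    (hy : y ∈ (extChartAt I x₀).target)
    (hfy : f ((extChartAt I x₀).symm y) ∈ (extChartAt I x₁).source) :
    ContDiffWithinAt ℝ ∞ (extChartAt I x₁ ∘ f ∘ (extChartAt I x₀).symm) (range I) y := by
  rw [← contMDiffWithinAt_iff_contDiffWithinAt]
  have h0 : ContMDiffWithinAt 𝓘(ℝ, E) I ∞ (extChartAt I x₀).symm (range I) y :=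
    contMDiffWithinAt_extChartAt_symm_range x₀ hy
  have h1 : ContMDiffAt I 𝓘(ℝ, E) ∞ (extChartAt I x₁) (f ((extChartAt I x₀).symm y)) :=
    contMDiffAt_extChartAt' (by simpa using hfy)
  exact h1.comp_contMDiffWithinAt y ((hf _).comp_contMDiffWithinAt y h0)

theorem inChart_pull {p : ℕ} {f : N → M} (hf : ContMDiff I I ∞ f)
    (α : FormField I M p) (x₀ : N) (x₁ : M) {y : E} (hy : y ∈ (extChartAt I x₀).target)
    (hfy : f ((extChartAt I x₀).symm y) ∈ (extChartAt I x₁).source) :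
    inChart (pull f α) x₀ y =
      (inChart α x₁ ((extChartAt I x₁ ∘ f ∘ (extChartAt I x₀).symm) y)).compContinuousLinearMap
        (fderivWithin ℝ (extChartAt I x₁ ∘ f ∘ (extChartAt I x₀).symm) (range I) y) := by
  have : IsManifold I 1 M := .of_le (n := ∞) (by simp)
  have : IsManifold I 1 N := .of_le (n := ∞) (by simp)
  have hyr : UniqueMDiffWithinAt 𝓘(ℝ, E) (range I) y :=
    I.uniqueMDiffOn _ (extChartAt_target_subset_range x₀ hy)
  have hfd : MDifferentiableAt I I f ((extChartAt I x₀).symm y) := (hf _).mdifferentiableAt (by simp)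
  have h0 := mdifferentiableWithinAt_extChartAt_symm (I := I) hy
  have h1 := mdifferentiableAt_extChartAt (I := I) (x := x₁)
    (y := f ((extChartAt I x₀).symm y)) (by simpa using hfy)
  have e2 := mfderiv_comp_mfderivWithin (I := 𝓘(ℝ, E)) (I' := I) (I'' := 𝓘(ℝ, E)) (s := range I)
    (f := f ∘ (extChartAt I x₀).symm) y h1 (hfd.comp_mdifferentiableWithinAt y h0) hyr
  rw [mfderivWithin_eq_fderivWithin, mfderiv_comp_mfderivWithin y hfd h0 hyr] at e2
  have e3 := mfderivWithin_extChartAt_symm_comp_mfderiv_extChartAt' (I := I) hfy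
  ext v
  refine FormField.apply_congr α ((extChartAt I x₁).left_inv hfy).symm (funext fun i ↦ ?_)
  have e2' := congrArg (fun L : E →L[ℝ] E ↦ L (v i)) e2
  have e3' := congrArg (fun L : E →L[ℝ] E ↦ L (mfderiv I I f ((extChartAt I x₀).symm y)
    (mfderivWithin 𝓘(ℝ, E) I (extChartAt I x₀).symm (range I) y (v i)))) e3
  refine e3'.symm.trans ?_
  refine congrArg (fun w : E ↦ (mfderivWithin 𝓘(ℝ, E) I (extChartAt I x₁).symm (range I)
    (extChartAt I x₁ (f ((extChartAt I x₀).symm y))) : E →L[ℝ] E) w) e2'.symm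

theorem inChart_pull_eventuallyEq {p : ℕ} {f : N → M} (hf : ContMDiff I I ∞ f)
    (α : FormField I M p) (x₀ : N) (x₁ : M) {y : E} (hy : y ∈ (extChartAt I x₀).target)
    (hfy : f ((extChartAt I x₀).symm y) ∈ (extChartAt I x₁).source) :
    inChart (pull f α) x₀ =ᶠ[𝓝[range I] y] fun y ↦
      (inChart α x₁ ((extChartAt I x₁ ∘ f ∘ (extChartAt I x₀).symm) y)).compContinuousLinearMap
        (fderivWithin ℝ (extChartAt I x₁ ∘ f ∘ (extChartAt I x₀).symm) (range I) y) := by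
  have hc : ContinuousWithinAt (f ∘ (extChartAt I x₀).symm) (range I) y :=
    hf.continuous.continuousAt.comp_continuousWithinAt
      ((continuousAt_extChartAt_symm'' hy).continuousWithinAt)
  filter_upwards [extChartAt_target_mem_nhdsWithin_of_mem hy,
    hc.preimage_mem_nhdsWithin ((isOpen_extChartAt_source x₁).mem_nhds hfy)] with z hz hz'
  exact inChart_pull hf α x₀ x₁ hz hz'

theorem IsSmooth.pull {p : ℕ} {α : FormField I M p} (h : IsSmooth α) {f : N → M}
    (hf : ContMDiff I I ∞ f) : IsSmooth (pull f α) := by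
  intro x₀ y hy
  have hfy := mem_extChartAt_source (I := I) (f ((extChartAt I x₀).symm y))
  have hyr := extChartAt_target_subset_range x₀ hy
  have ht := contDiffWithinAt_transition hf x₀ _ hy hfy
  have hmaps : MapsTo (extChartAt I (f ((extChartAt I x₀).symm y)) ∘ f ∘ (extChartAt I x₀).symm)
      (range I) (range I) := by
    intro z _
    simp
  have e := inChart_pull_eventuallyEq hf α x₀ _ hy hfy
  refine ContDiffWithinAt.mono ?_ (extChartAt_target_subset_range x₀)
  refine ContDiffWithinAt.congr_of_eventuallyEq ?_ e (e.self_of_nhdsWithin hyr)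
  refine contDiffWithinAt_compCLM ?_ ?_
  · refine ContDiffWithinAt.comp y (h.contDiffWithinAt _ ?_) ht hmaps
    exact (extChartAt I _).map_source hfy
  · exact ht.fderivWithin_right I.uniqueDiffOn (by simp) hyr


theorem fderivWithin_transition_apply {f : N → M} (hf : ContMDiff I I ∞ f) (x₀ : N) (x₁ : M) {x : N}
    (hx : x ∈ (extChartAt I x₀).source) (hfx : f x ∈ (extChartAt I x₁).source) (v : E) :
    fderivWithin ℝ (extChartAt I x₁ ∘ f ∘ (extChartAt I x₀).symm) (range I) (extChartAt I x₀ x) v =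
      mfderiv I 𝓘(ℝ, E) (extChartAt I x₁) (f x) (mfderiv I I f x
        (mfderivWithin 𝓘(ℝ, E) I (extChartAt I x₀).symm (range I) (extChartAt I x₀ x) v)) := by
  have : IsManifold I 1 M := .of_le (n := ∞) (by simp)
  have : IsManifold I 1 N := .of_le (n := ∞) (by simp)
  have hy := (extChartAt I x₀).map_source hx
  have hyr : UniqueMDiffWithinAt 𝓘(ℝ, E) (range I) (extChartAt I x₀ x) :=
    I.uniqueMDiffOn _ (extChartAt_target_subset_range x₀ hy)
  have hfd : MDifferentiableAt I I f x := (hf _).mdifferentiableAt (by simp)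
  have h0 := mdifferentiableWithinAt_extChartAt_symm (I := I) hy
  have hxx := (extChartAt I x₀).left_inv hx
  have h1 := mdifferentiableAt_extChartAt (I := I) (x := x₁) (y := f x) (by simpa using hfx)
  have hc : MDifferentiableWithinAt 𝓘(ℝ, E) I (f ∘ (extChartAt I x₀).symm) (range I)
      (extChartAt I x₀ x) := by
    refine MDifferentiableAt.comp_mdifferentiableWithinAt _ ?_ h0
    rwa [hxx]
  have e2 := mfderiv_comp_mfderivWithin_of_eq (I := 𝓘(ℝ, E)) (I' := I) (I'' := 𝓘(ℝ, E))
    (s := range I) (f := f ∘ (extChartAt I x₀).symm) h1 hc hyr (congrArg f hxx)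
  rw [mfderivWithin_eq_fderivWithin, mfderiv_comp_mfderivWithin_of_eq hfd h0 hyr hxx] at e2
  exact congrArg (fun L : E →L[ℝ] E ↦ L v) e2

theorem extDerivWithin_inChart_pull {p : ℕ} {α : FormField I M p} (h : IsSmooth α) {f : N → M}
    (hf : ContMDiff I I ∞ f) (x₀ : N) (x₁ : M) {y : E} (hy : y ∈ (extChartAt I x₀).target)
    (hfy : f ((extChartAt I x₀).symm y) ∈ (extChartAt I x₁).source) :
    extDerivWithin (inChart (pull f α) x₀) (range I) y =
      (extDerivWithin (inChart α x₁) (range I)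
        ((extChartAt I x₁ ∘ f ∘ (extChartAt I x₀).symm) y)).compContinuousLinearMap
        (fderivWithin ℝ (extChartAt I x₁ ∘ f ∘ (extChartAt I x₀).symm) (range I) y) := by
  have hyr := extChartAt_target_subset_range x₀ hy
  rw [(inChart_pull_eventuallyEq hf α x₀ x₁ hy hfy).extDerivWithin_eq_of_mem hyr]
  exact extDerivWithin_pullback (r := ∞)
    ((h.contDiffWithinAt x₁ ((extChartAt I x₁).map_source hfy)).differentiableWithinAt (by simp))
    (contDiffWithinAt_transition hf x₀ x₁ hy hfy) (by simpa using two_le_infty) I.uniqueDiffOn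
    (I.range_subset_closure_interior hyr) hyr (mapsTo_transition x₀ x₁)

theorem extD_pull {p : ℕ} {α : FormField I M p} (h : IsSmooth α) {f : N → M}
    (hf : ContMDiff I I ∞ f) : extD (pull f α) = pull f (extD α) := by
  have : IsManifold I 1 M := .of_le (n := ∞) (by simp)
  have : IsManifold I 1 N := .of_le (n := ∞) (by simp)
  funext x
  have hx := mem_extChartAt_source (I := I) x
  have hxx := (extChartAt I x).left_inv hx
  have key := extDerivWithin_inChart_pull h hf x (f x) ((extChartAt I x).map_source hx)
    (by rw [hxx]; exact mem_extChartAt_source _)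
  simp only [extD, pull] at key ⊢
  rw [key]
  ext v
  have e : ∀ w : E, fderivWithin ℝ (extChartAt I (f x) ∘ f ∘ (extChartAt I x).symm) (range I)
      (extChartAt I x x) (mfderiv I 𝓘(ℝ, E) (extChartAt I x) x w) =
      mfderiv I 𝓘(ℝ, E) (extChartAt I (f x)) (f x) (mfderiv I I f x w) := by
    intro w
    refine (fderivWithin_transition_apply hf x (f x) hx (mem_extChartAt_source _) _).trans ?_
    have e3 := congrArg (fun L : E →L[ℝ] E ↦ L w)
      (mfderivWithin_extChartAt_symm_comp_mfderiv_extChartAt' (I := I) hx)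
    exact congrArg (fun u : E ↦ (mfderiv I 𝓘(ℝ, E) (extChartAt I (f x)) (f x) : E →L[ℝ] E)
      ((mfderiv I I f x : E →L[ℝ] E) u)) e3
  have e' : (extChartAt I (f x) ∘ f ∘ (extChartAt I x).symm) (extChartAt I x x) =
      extChartAt I (f x) (f x) := by simp
  rw [e']
  exact congrArg (extDerivWithin (inChart α (f x)) (range I) (extChartAt I (f x) (f x)))
    (funext fun i ↦ e (v i))

theorem inChart_extD {p : ℕ} {α : FormField I M p} (h : IsSmooth α) (x₀ : M) {y : E}
    (hy : y ∈ (extChartAt I x₀).target) :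
    inChart (extD α) x₀ y = extDerivWithin (inChart α x₀) (range I) y := by
  obtain ⟨x, hx, rfl⟩ : ∃ x, x ∈ (extChartAt I x₀).source ∧ extChartAt I x₀ x = y :=
    ⟨_, (extChartAt I x₀).map_target hy, (extChartAt I x₀).right_inv hy⟩
  have hxx := (extChartAt I x₀).left_inv hx
  have key := extDerivWithin_inChart_pull h contMDiff_id x₀ x hy
    (by rw [hxx]; exact mem_extChartAt_source _)
  rw [pull_id] at key
  rw [key]
  ext v
  refine (FormField.apply_congr (extD α) hxx rfl).trans ?_
  have e' : (extChartAt I x ∘ id ∘ (extChartAt I x₀).symm) (extChartAt I x₀ x) =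
      extChartAt I x x := congrArg (extChartAt I x) hxx
  rw [e']
  refine congrArg (extDerivWithin (inChart α x) (range I) (extChartAt I x x)) (funext fun i ↦ ?_)
  refine Eq.trans ?_ (fderivWithin_transition_apply contMDiff_id x₀ x hx
    (mem_extChartAt_source _) (v i)).symm
  have e3 := congrArg (fun L : E →L[ℝ] E ↦ L (mfderivWithin 𝓘(ℝ, E) I (extChartAt I x₀).symm
    (range I) (extChartAt I x₀ x) (v i))) (mfderiv_id (I := I) (x := x))
  exact congrArg (fun u : E ↦ (mfderiv I 𝓘(ℝ, E) (extChartAt I x) x : E →L[ℝ] E) u) e3.symm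

theorem IsSmooth.extD {p : ℕ} {α : FormField I M p} (h : IsSmooth α) : IsSmooth (extD α) := by
  intro x₀ y hy
  have hyr := extChartAt_target_subset_range x₀ hy
  refine ContDiffWithinAt.congr (f := extDerivWithin (inChart α x₀) (range I)) ?_
    (fun z hz ↦ inChart_extD h x₀ hz) (inChart_extD h x₀ hy)
  refine ContDiffWithinAt.mono ?_ (extChartAt_target_subset_range x₀)
  exact (ContinuousAlternatingMap.alternatizeUncurryFinCLM ℝ E ℝ).contDiff.comp_contDiffWithinAt
    ((h.contDiffWithinAt x₀ hy).fderivWithin_right I.uniqueDiffOn (m := ∞) (by simp) hyr)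

theorem extD_extD {p : ℕ} {α : FormField I M p} (h : IsSmooth α) : extD (extD α) = 0 := by
  funext x
  have hy := mem_extChartAt_target (I := I) x
  have hyr := extChartAt_target_subset_range x hy
  have e : inChart (extD α) x =ᶠ[𝓝[range I] extChartAt I x x]
      extDerivWithin (inChart α x) (range I) := by
    filter_upwards [extChartAt_target_mem_nhdsWithin_of_mem hy] with z hz
    exact inChart_extD h x hz
  have e0 : extDerivWithin (inChart (extD α) x) (range I) (extChartAt I x x) = 0 := by
    rw [e.extDerivWithin_eq_of_mem hyr]
    exact extDerivWithin_extDerivWithin_apply (h.contDiffWithinAt x hy) (by simpa using two_le_infty)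
      I.uniqueDiffOn (I.range_subset_closure_interior hyr) hyr
  ext v
  exact congrArg (fun L : E [⋀^Fin (p + 2)]→L[ℝ] ℝ ↦
    L fun i ↦ mfderiv I 𝓘(ℝ, E) (extChartAt I x) x (v i)) e0

variable (I M) in
/-- The exterior derivative `d : Ω^p(M) → Ω^{p+1}(M)`. -/
def d (p : ℕ) : DForm I M p →ₗ[ℝ] DForm I M (p + 1) where
  toFun α := ⟨extD α.1, IsSmooth.extD (α := α.1) α.2⟩
  map_add' := by
    rintro ⟨α, ha⟩ ⟨β, hb⟩
    refine Subtype.ext (funext fun x ↦ ContinuousAlternatingMap.ext fun v ↦ ?_)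
    have hy := mem_extChartAt_target (I := I) x
    have e := extDerivWithin_add (I.uniqueDiffOn _ (extChartAt_target_subset_range x hy))
      ((IsSmooth.contDiffWithinAt (α := α) ha x hy).differentiableWithinAt (by simp))
      ((IsSmooth.contDiffWithinAt (α := β) hb x hy).differentiableWithinAt (by simp))
    exact congrArg (fun L : E [⋀^Fin (p + 1)]→L[ℝ] ℝ ↦
      L fun i ↦ mfderiv I 𝓘(ℝ, E) (extChartAt I x) x (v i)) e
  map_smul' := by
    rintro c ⟨α, ha⟩
    refine Subtype.ext (funext fun x ↦ ContinuousAlternatingMap.ext fun v ↦ ?_)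
    have hy := mem_extChartAt_target (I := I) x
    have e := extDerivWithin_smul c (inChart α x)
      (I.uniqueDiffOn _ (extChartAt_target_subset_range x hy))
    exact congrArg (fun L : E [⋀^Fin (p + 1)]→L[ℝ] ℝ ↦
      L fun i ↦ mfderiv I 𝓘(ℝ, E) (extChartAt I x) x (v i)) e

theorem d_d (p : ℕ) (α : DForm I M p) : d I M (p + 1) (d I M p α) = 0 :=
  Subtype.ext (extD_extD (α := α.1) α.2)

/-- The pullback `f^* : Ω^p(M) → Ω^p(N)` along a smooth map `f : N → M`. -/
def pullback (f : C^∞⟮I, N; I, M⟯) (p : ℕ) : DForm I M p →ₗ[ℝ] DForm I N p where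
  toFun α := ⟨pull f α.1, IsSmooth.pull (α := α.1) α.2 f.contMDiff⟩
  map_add' _ _ := rfl
  map_smul' _ _ := rfl

theorem d_pullback (f : C^∞⟮I, N; I, M⟯) (p : ℕ) (α : DForm I M p) :
    d I N p (pullback f p α) = pullback f (p + 1) (d I M p α) :=
  Subtype.ext (extD_pull (α := α.1) α.2 f.contMDiff)

theorem pullback_pullback_of_involutive (τ : C^∞⟮I, M; I, M⟯) (hτ : Function.Involutive τ) (p : ℕ)
    (α : DForm I M p) : pullback τ p (pullback τ p α) = α := by
  refine Subtype.ext ?_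
  have h := pull_comp τ.contMDiff τ.contMDiff α.1
  rw [hτ.comp_self, pull_id] at h
  exact h

end Forms

/-! ### Cohomology of a cochain complex -/

section Cohomology

variable {C : ℕ → Type*} [∀ p, AddCommGroup (C p)] [∀ p, Module ℝ (C p)]
  {D : ℕ → Type*} [∀ p, AddCommGroup (D p)] [∀ p, Module ℝ (D p)]

/-- The coboundaries `d C^{p-1} ⊆ C^p`; they are zero for `p = 0`. -/
def coboundaries (dC : ∀ p, C p →ₗ[ℝ] C (p + 1)) : ∀ p, Submodule ℝ (C p)
  | 0 => ⊥
  | p + 1 => LinearMap.range (dC p)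

/-- The `p`-th cohomology `ker (d : C^p → C^{p+1}) / d C^{p-1}`. -/
abbrev Cohomology (dC : ∀ p, C p →ₗ[ℝ] C (p + 1)) (p : ℕ) : Type _ :=
  LinearMap.ker (dC p) ⧸ (coboundaries dC p).submoduleOf (LinearMap.ker (dC p))

/-- The class of a cocycle. -/
def cohomologyClass (dC : ∀ p, C p →ₗ[ℝ] C (p + 1)) (p : ℕ) :
    LinearMap.ker (dC p) →ₗ[ℝ] Cohomology dC p :=
  Submodule.mkQ _

/-- The map `[a] ↦ [F a]` in cohomology induced by a cochain map `F`. -/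
def cohomologyMap (dC : ∀ p, C p →ₗ[ℝ] C (p + 1)) (dD : ∀ p, D p →ₗ[ℝ] D (p + 1))
    (F : ∀ p, C p →ₗ[ℝ] D p) (hF : ∀ p a, dD p (F p a) = F (p + 1) (dC p a)) (p : ℕ) :
    Cohomology dC p →ₗ[ℝ] Cohomology dD p :=
  Submodule.mapQ _ _
    ((F p).restrict (p := LinearMap.ker (dC p)) (q := LinearMap.ker (dD p)) fun a ha ↦ by
      rw [LinearMap.mem_ker] at ha ⊢
      rw [hF, ha, map_zero]) <| by
    rintro ⟨a, ha⟩ h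
    cases p with
    | zero =>
      have h' : a = 0 := h
      subst h'
      exact map_zero (F 0)
    | succ p =>
      obtain ⟨b, hb⟩ : ∃ b, dC p b = a := h
      exact ⟨F p b, by rw [hF, hb]; rfl⟩

end Cohomology

/-! ### Equivariant and Real de Rham cohomology -/

section Involution

variable {E : Type*} [NormedAddCommGroup E] [NormedSpace ℝ E]
  {H : Type*} [TopologicalSpace H] {I : ModelWithCorners ℝ E H}
  {M : Type*} [TopologicalSpace M] [ChartedSpace H M] [IsManifold I ∞ M]

variable (I M) in
/-- The de Rham cohomology `H^p_dR(M)`. -/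
abbrev HdR (p : ℕ) : Type _ := Cohomology (C := fun p ↦ DForm I M p) (d I M) p

/-- The space `Ω^p_±(M)` of forms with `τ^* α = ± α`; the sign is `ε`. -/
def signedForms (τ : C^∞⟮I, M; I, M⟯) (ε : ℤˣ) (p : ℕ) : Submodule ℝ (DForm I M p) :=
  LinearMap.eqLocus (pullback τ p) (((ε : ℤ) : ℝ) • LinearMap.id)

/-- The exterior derivative `d : Ω^p_±(M) → Ω^{p+1}_±(M)`. -/
def signedD (τ : C^∞⟮I, M; I, M⟯) (ε : ℤˣ) (p : ℕ) :
    signedForms τ ε p →ₗ[ℝ] signedForms τ ε (p + 1) :=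
  (d I M p).restrict fun α hα ↦ by
    have h : pullback τ p α = ((ε : ℤ) : ℝ) • α := hα
    change pullback τ (p + 1) (d I M p α) = ((ε : ℤ) : ℝ) • d I M p α
    rw [← d_pullback, h, map_smul]

/-- The cohomology `H^p_{dR±}(M) = Ω^p_{± cl}(M) / d Ω^{p-1}_±(M)`: the equivariant de Rham
cohomology for `ε = 1` and the Real de Rham cohomology for `ε = -1`. -/
abbrev HdRSigned (τ : C^∞⟮I, M; I, M⟯) (ε : ℤˣ) (p : ℕ) : Type _ :=
  Cohomology (C := fun p ↦ signedForms τ ε p) (signedD τ ε) p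

/-- The inclusion `V → M` of an open subset. -/
def openIncl (V : Opens M) : C^∞⟮I, V; I, M⟯ := ⟨Subtype.val, contMDiff_subtype_val⟩

variable (τ : C^∞⟮I, M; I, M⟯) (hτ : Function.Involutive τ) (V : Opens M)

/-- The open subset `U = V ∩ τ(V)`. -/
def overlap : Opens M :=
  ⟨(V : Set M) ∩ τ '' (V : Set M), V.isOpen.inter <| by
    rw [image_eq_preimage_of_inverse hτ.leftInverse hτ.rightInverse]
    exact V.isOpen.preimage τ.contMDiff.continuous⟩

/-- The inclusion `U → V`. -/
def overlapIncl : C^∞⟮I, overlap τ hτ V; I, V⟯ :=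
  ⟨Opens.inclusion (fun _ hx ↦ hx.1), contMDiff_inclusion _⟩

/-- The restriction `U → U` of the involution `τ`. -/
def overlapInvol : C^∞⟮I, overlap τ hτ V; I, overlap τ hτ V⟯ :=
  ⟨fun u ↦ ⟨τ u, by
    obtain ⟨x, hx⟩ := u
    obtain ⟨h1, y, h2, h3⟩ := hx
    refine ⟨?_, x, h1, rfl⟩
    change τ x ∈ (V : Set M)
    rw [← h3, hτ y]
    exact h2⟩,
    (ContMDiff.subtypeVal_comp_iff _ _).1 (τ.contMDiff.comp contMDiff_subtype_val)⟩

theorem overlapInvol_involutive : Function.Involutive (overlapInvol τ hτ V) :=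
  fun u ↦ Subtype.ext (hτ u)

/-- The restriction map `ι^* : Ω^p_±(M) → Ω^p(V)`. -/
def restrictForm (ε : ℤˣ) (p : ℕ) : signedForms τ ε p →ₗ[ℝ] DForm I V p :=
  (pullback (openIncl V) p).domRestrict (signedForms τ ε p)

theorem d_restrictForm (ε : ℤˣ) (p : ℕ) (α : signedForms τ ε p) :
    d I V p (restrictForm τ V ε p α) = restrictForm τ V ε (p + 1) (signedD τ ε p α) :=
  d_pullback _ p α.1

/-- The map `(1 ± τ^*) j^* : Ω^p(V) → Ω^p_±(U)`. -/
def symmetrize (ε : ℤˣ) (p : ℕ) :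
    DForm I V p →ₗ[ℝ] signedForms (overlapInvol τ hτ V) ε p :=
  LinearMap.codRestrict (signedForms (overlapInvol τ hτ V) ε p)
    ((LinearMap.id + ((ε : ℤ) : ℝ) • pullback (overlapInvol τ hτ V) p) ∘ₗ
      pullback (overlapIncl τ hτ V) p) fun α ↦ by
    have h := pullback_pullback_of_involutive _ (overlapInvol_involutive τ hτ V) p
      (pullback (overlapIncl τ hτ V) p α)
    have hε : ((ε : ℤ) : ℝ) * ((ε : ℤ) : ℝ) = 1 := by
      exact_mod_cast Int.units_coe_mul_self ε
    simp only [signedForms, LinearMap.mem_eqLocus, LinearMap.comp_apply, LinearMap.add_apply,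
      LinearMap.smul_apply, LinearMap.id_apply, map_add, map_smul, h, smul_smul, hε,
      one_smul]
    exact add_comm _ _

theorem coe_symmetrize (ε : ℤˣ) (p : ℕ) (α : DForm I V p) :
    (symmetrize τ hτ V ε p α : DForm I (overlap τ hτ V) p) =
      pullback (overlapIncl τ hτ V) p α + ((ε : ℤ) : ℝ) •
        pullback (overlapInvol τ hτ V) p (pullback (overlapIncl τ hτ V) p α) :=
  rfl

theorem d_symmetrize (ε : ℤˣ) (p : ℕ) (α : DForm I V p) :
    signedD (overlapInvol τ hτ V) ε p (symmetrize τ hτ V ε p α) =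
      symmetrize τ hτ V ε (p + 1) (d I V p α) := by
  refine Subtype.ext ?_
  rw [coe_symmetrize, ← d_pullback, ← d_pullback, ← map_smul, ← map_add, ← coe_symmetrize]
  rfl

/-- The map `ι^* : H^p_{dR±}(M) → H^p_dR(V)`. -/
def restrictCoh (ε : ℤˣ) (p : ℕ) : HdRSigned τ ε p →ₗ[ℝ] HdR I V p :=
  cohomologyMap (C := fun p ↦ signedForms τ ε p) (D := fun p ↦ DForm I V p)
    _ _ (restrictForm τ V ε) (d_restrictForm τ V ε) p

/-- The map `(1 ± τ^*) j^* : H^p_dR(V) → H^p_{dR±}(U)`. -/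
def symmetrizeCoh (ε : ℤˣ) (p : ℕ) :
    HdR I V p →ₗ[ℝ] HdRSigned (overlapInvol τ hτ V) ε p :=
  cohomologyMap (C := fun p ↦ DForm I V p)
    (D := fun p ↦ signedForms (overlapInvol τ hτ V) ε p) _ _ (symmetrize τ hτ V ε) (d_symmetrize τ hτ V ε) p

/-- `(f, τ^* f)` is a smooth partition of unity subordinate to the cover `(V, τ(V))`. -/
structure IsSymmetricPartition (f : C^∞⟮I, M; 𝓘(ℝ), ℝ⟯) : Prop where
  nonneg : ∀ x, 0 ≤ f x
  tsupport_subset : tsupport f ⊆ V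
  tsupport_comp_subset : tsupport (f ∘ τ) ⊆ τ '' (V : Set M)
  add_eq_one : ∀ x, f x + f (τ x) = 1

end Involution

end InvolutiveDeRham

end

open Set Filter TopologicalSpace
open scoped Manifold ContDiff Topology

noncomputable section

namespace InvolutiveDeRham

/-! ### The long exact sequence of a short exact sequence of cochain complexes -/

section LongExactSequence

variable {A : ℕ → Type*} [∀ p, AddCommGroup (A p)] [∀ p, Module ℝ (A p)]
  {B : ℕ → Type*} [∀ p, AddCommGroup (B p)] [∀ p, Module ℝ (B p)]
  {C : ℕ → Type*} [∀ p, AddCommGroup (C p)] [∀ p, Module ℝ (C p)]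
  {dA : ∀ p, A p →ₗ[ℝ] A (p + 1)} {dB : ∀ p, B p →ₗ[ℝ] B (p + 1)} {dC : ∀ p, C p →ₗ[ℝ] C (p + 1)}
  {i : ∀ p, A p →ₗ[ℝ] B p} {q : ∀ p, B p →ₗ[ℝ] C p}

/-! Since V and τ(V) cover X, a form with τ^*ω = ∓ω is determined by its restriction to V.
Conversely, a form η on V is such a restriction exactly when η and ∓τ^*η agree on U, for then the
two glue to a smooth form on X. This gives exactness on the left and in the middle
(`restrictForm_injective`, `exact_restrictForm_symmetrize`). Only surjectivity needs a partition of
unity. Averaging an ordinary one over τ gives a pair (f, τ^*f), and (τ^*f)ρ, extended by zero from U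
to V, symmetrizes to (τ^*f + f)ρ = ρ (`exists_isSymmetricPartition`,
`IsSymmetricPartition.exists_preimage`).

The maps commute with d, so the rest is the long exact sequence of a short exact sequence of
complexes. It is proved by diagram chases that rest on `mem_range_of_mem_coboundaries` and
`exists_connectingMap`.

To compare forms on X, V and U, all of them are moved to X: a form on an open subset is extended by
zero to a possibly discontinuous form on X, and smoothness is tested point by point. Charts of an
open subset are restrictions of charts of X, so neither values nor smoothness change under
restriction. -/

theorem cohomologyClass_surjective (p : ℕ) : Function.Surjective (cohomologyClass dA p) :=
  Submodule.mkQ_surjective _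

theorem cohomologyClass_eq_zero_iff {p : ℕ} (a : LinearMap.ker (dA p)) :
    cohomologyClass dA p a = 0 ↔ a.1 ∈ coboundaries dA p :=
  Submodule.Quotient.mk_eq_zero _

theorem cohomologyMap_cohomologyClass (hi : ∀ p a, dB p (i p a) = i (p + 1) (dA p a)) {p : ℕ}
    (a : LinearMap.ker (dA p)) (h : i p a.1 ∈ LinearMap.ker (dB p)) :
    cohomologyMap dA dB i hi p (cohomologyClass dA p a) = cohomologyClass dB p ⟨i p a.1, h⟩ :=
  rfl

theorem map_mem_ker_of_mem_ker (hi : ∀ p a, dB p (i p a) = i (p + 1) (dA p a)) {p : ℕ}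
    (a : LinearMap.ker (dA p)) : i p a.1 ∈ LinearMap.ker (dB p) := by
  rw [LinearMap.mem_ker, hi, LinearMap.mem_ker.1 a.2, map_zero]

/-- If q η = dC (q b), then η - dB b comes from some a in A and has the same differential as η, so
injectivity of i gives α = dA a. This yields both halves of well-definedness of the connecting map:
vanishing on coboundaries and independence of the lift. Degree 0 is separate because its only
coboundary is 0. -/
theorem mem_range_of_mem_coboundaries
    (hi : ∀ p a, dB p (i p a) = i (p + 1) (dA p a)) (hq : ∀ p b, dC p (q p b) = q (p + 1) (dB p b))
    (hdB : ∀ p b, dB (p + 1) (dB p b) = 0) (hinj : ∀ p, Function.Injective (i p))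
    (hex : ∀ p, Function.Exact (i p) (q p)) (hsurj : ∀ p, Function.Surjective (q p))
    {p : ℕ} {η : B p} {α : A (p + 1)} (hη : q p η ∈ coboundaries dC p)
    (hα : i (p + 1) α = dB p η) : α ∈ LinearMap.range (dA p) := by
  obtain ⟨a, ha⟩ : ∃ a, dB p (i p a) = dB p η := by
    cases p with
    | zero =>
      obtain ⟨a, ha⟩ := (hex 0 η).1 hη
      exact ⟨a, by rw [ha]⟩
    | succ p =>
      obtain ⟨c, hc⟩ : ∃ c, dC p c = q (p + 1) η := hη
      obtain ⟨b, rfl⟩ := hsurj p c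
      obtain ⟨a, ha⟩ := (hex (p + 1) (η - dB p b)).1 (by rw [map_sub, ← hc, hq, sub_self])
      exact ⟨a, by rw [ha, map_sub, hdB, sub_zero]⟩
  exact ⟨a, hinj _ (by rw [← hi, ha, hα])⟩

/-- The connecting maps of a short exact sequence of cochain complexes. -/
theorem exists_connectingMap
    (hi : ∀ p a, dB p (i p a) = i (p + 1) (dA p a)) (hq : ∀ p b, dC p (q p b) = q (p + 1) (dB p b))
    (hdB : ∀ p b, dB (p + 1) (dB p b) = 0) (hinj : ∀ p, Function.Injective (i p))
    (hex : ∀ p, Function.Exact (i p) (q p)) (hsurj : ∀ p, Function.Surjective (q p)) (p : ℕ) :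
    ∃ Δ : Cohomology dC p →ₗ[ℝ] Cohomology dA (p + 1),
      ∀ (ρ : LinearMap.ker (dC p)) (η : B p) (α : LinearMap.ker (dA (p + 1))),
        q p η = ρ.1 → i (p + 1) α.1 = dB p η →
        Δ (cohomologyClass dC p ρ) = cohomologyClass dA (p + 1) α := by
  -- Over a field there are a linear section s of q and a linear retraction r of i. They need not
  -- commute with the differentials, but they make r ∘ dB ∘ s linear by construction.
  obtain ⟨s, hs⟩ := (q p).exists_rightInverse_of_surjective (LinearMap.range_eq_top.2 (hsurj p))
  obtain ⟨r, hr⟩ := (i (p + 1)).exists_leftInverse_of_injective (LinearMap.ker_eq_bot.2 (hinj _))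
  have hs' : ∀ c, q p (s c) = c := fun c ↦ LinearMap.congr_fun hs c
  have hr' : ∀ a, r (i (p + 1) a) = a := fun a ↦ LinearMap.congr_fun hr a
  have hlift : ∀ c : LinearMap.ker (dC p), i (p + 1) (r (dB p (s c.1))) = dB p (s c.1) := by
    rintro ⟨c, hc⟩
    obtain ⟨a, ha⟩ := (hex (p + 1) (dB p (s c))).1 (by rw [← hq, hs']; exact hc)
    change i (p + 1) (r (dB p (s c))) = dB p (s c)
    rw [← ha, hr']
  let L : LinearMap.ker (dC p) →ₗ[ℝ] LinearMap.ker (dA (p + 1)) :=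
    LinearMap.codRestrict _ (r ∘ₗ dB p ∘ₗ s ∘ₗ (LinearMap.ker (dC p)).subtype) fun c ↦ by
      refine LinearMap.mem_ker.2 (hinj _ ?_)
      rw [map_zero, ← hi]
      exact (congrArg _ (hlift c)).trans (hdB _ _)
  have hL : ∀ c, i (p + 1) (L c).1 = dB p (s c.1) := hlift
  refine ⟨Submodule.liftQ _ (cohomologyClass dA (p + 1) ∘ₗ L) ?_, fun ρ η α hη hα ↦ ?_⟩
  · intro c hc
    refine (cohomologyClass_eq_zero_iff _).2
      (mem_range_of_mem_coboundaries hi hq hdB hinj hex hsurj (η := s c.1) ?_ (hL c))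
    rw [hs']
    exact hc
  · change cohomologyClass dA (p + 1) (L ρ) = _
    rw [← sub_eq_zero, ← map_sub, cohomologyClass_eq_zero_iff]
    -- Two lifts of ρ differ by an element with q-image 0, which is in particular a coboundary.
    refine mem_range_of_mem_coboundaries hi hq hdB hinj hex hsurj (η := s ρ.1 - η) ?_ ?_
    · rw [map_sub, hs', hη, sub_self]
      exact zero_mem _
    · rw [map_sub, ← hL, ← hα, ← map_sub]
      rfl

theorem cohomologyMap_zero_injective (hi : ∀ p a, dB p (i p a) = i (p + 1) (dA p a))
    (hinj : Function.Injective (i 0)) : Function.Injective (cohomologyMap dA dB i hi 0) := by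
  refine (injective_iff_map_eq_zero _).2 fun x hx ↦ ?_
  obtain ⟨a, rfl⟩ := cohomologyClass_surjective 0 x
  rw [cohomologyMap_cohomologyClass hi a (map_mem_ker_of_mem_ker hi a),
    cohomologyClass_eq_zero_iff] at hx
  exact (cohomologyClass_eq_zero_iff _).2 (hinj (Eq.trans hx (map_zero _).symm))

theorem exact_cohomologyMap
    (hi : ∀ p a, dB p (i p a) = i (p + 1) (dA p a)) (hq : ∀ p b, dC p (q p b) = q (p + 1) (dB p b))
    (hdB : ∀ p b, dB (p + 1) (dB p b) = 0) (hinj : ∀ p, Function.Injective (i p))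
    (hex : ∀ p, Function.Exact (i p) (q p)) (hsurj : ∀ p, Function.Surjective (q p)) (p : ℕ) :
    Function.Exact (cohomologyMap dA dB i hi p) (cohomologyMap dB dC q hq p) := by
  intro x
  obtain ⟨b, rfl⟩ := cohomologyClass_surjective p x
  rw [cohomologyMap_cohomologyClass hq b (map_mem_ker_of_mem_ker hq b),
    cohomologyClass_eq_zero_iff]
  constructor
  · intro h
    -- A coboundary b' is subtracted so that b - b' lies in the kernel of q, hence in the image of
    -- i. In degree 0 the value q b itself vanishes and b' = 0 suffices.
    obtain ⟨b', hb', a, ha⟩ : ∃ b', b' ∈ coboundaries dB p ∧ ∃ a, i p a = b.1 - b' := by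
      cases p with
      | zero => exact ⟨0, zero_mem _, (hex 0 _).1 (by rw [sub_zero]; exact h)⟩
      | succ p =>
        obtain ⟨c, hc⟩ : ∃ c, dC p c = q (p + 1) b.1 := h
        obtain ⟨e, rfl⟩ := hsurj p c
        exact ⟨dB p e, ⟨e, rfl⟩, (hex (p + 1) _).1 (by rw [map_sub, ← hc, hq, sub_self])⟩
    have hb'0 : dB p b' = 0 := by
      cases p with
      | zero => rw [show b' = 0 from hb', map_zero]
      | succ p =>
        obtain ⟨e, rfl⟩ : ∃ e, dB p e = b' := hb'
        exact hdB _ _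
    have hk : a ∈ LinearMap.ker (dA p) := by
      refine LinearMap.mem_ker.2 (hinj _ ?_)
      rw [← hi, ha, map_sub, hb'0, LinearMap.mem_ker.1 b.2, sub_zero, map_zero]
    refine ⟨cohomologyClass dA p ⟨a, hk⟩, ?_⟩
    rw [cohomologyMap_cohomologyClass hi ⟨a, hk⟩ (map_mem_ker_of_mem_ker hi _), ← sub_eq_zero,
      ← map_sub, cohomologyClass_eq_zero_iff]
    change i p a - b.1 ∈ _
    rw [ha, sub_sub_cancel_left]
    exact neg_mem hb'
  · rintro ⟨y, hy⟩
    obtain ⟨a, rfl⟩ := cohomologyClass_surjective p y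
    rw [cohomologyMap_cohomologyClass hi a (map_mem_ker_of_mem_ker hi a), ← sub_eq_zero, ← map_sub,
      cohomologyClass_eq_zero_iff] at hy
    replace hy : i p a.1 - b.1 ∈ coboundaries dB p := hy
    have hqa : q p (i p a.1) = 0 := (hex p).apply_apply_eq_zero _
    cases p with
    | zero =>
      change q 0 b.1 = 0
      rwa [← sub_eq_zero.1 (show i 0 a.1 - b.1 = 0 from hy)]
    | succ p =>
      obtain ⟨e, he⟩ : ∃ e, dB p e = i (p + 1) a.1 - b.1 := hy
      refine ⟨-q p e, ?_⟩
      rw [map_neg, hq, he, map_sub, hqa, zero_sub, neg_neg]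

theorem exact_cohomologyMap_connectingMap
    (hi : ∀ p a, dB p (i p a) = i (p + 1) (dA p a)) (hq : ∀ p b, dC p (q p b) = q (p + 1) (dB p b))
    (hdB : ∀ p b, dB (p + 1) (dB p b) = 0) (hinj : ∀ p, Function.Injective (i p))
    (hex : ∀ p, Function.Exact (i p) (q p)) (hsurj : ∀ p, Function.Surjective (q p)) {p : ℕ}
    {Δ : Cohomology dC p →ₗ[ℝ] Cohomology dA (p + 1)}
    (hΔ : ∀ (ρ : LinearMap.ker (dC p)) (η : B p) (α : LinearMap.ker (dA (p + 1))),
      q p η = ρ.1 → i (p + 1) α.1 = dB p η →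
      Δ (cohomologyClass dC p ρ) = cohomologyClass dA (p + 1) α) :
    Function.Exact (cohomologyMap dB dC q hq p) Δ := by
  intro x
  obtain ⟨c, rfl⟩ := cohomologyClass_surjective p x
  constructor
  · intro h
    obtain ⟨b, hb⟩ := hsurj p c.1
    obtain ⟨a, ha⟩ := (hex (p + 1) (dB p b)).1 (by rw [← hq, hb]; exact c.2)
    have hk : a ∈ LinearMap.ker (dA (p + 1)) := by
      refine LinearMap.mem_ker.2 (hinj _ ?_)
      rw [← hi, ha, hdB, map_zero]
    rw [hΔ c b ⟨a, hk⟩ hb ha, cohomologyClass_eq_zero_iff] at h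
    obtain ⟨a', ha'⟩ : ∃ a', dA p a' = a := h
    -- Here dB b = i a = i (dA a'), so subtracting i a' turns the lift b of c into a cocycle without
    -- changing its image under q.
    have hbk : b - i p a' ∈ LinearMap.ker (dB p) := by
      rw [LinearMap.mem_ker, map_sub, hi, ha', ha, sub_self]
    refine ⟨cohomologyClass dB p ⟨b - i p a', hbk⟩, ?_⟩
    rw [cohomologyMap_cohomologyClass hq ⟨b - i p a', hbk⟩ (map_mem_ker_of_mem_ker hq _)]
    congr 1
    refine Subtype.ext ?_
    change q p (b - i p a') = c.1
    rw [map_sub, (hex p).apply_apply_eq_zero, sub_zero, hb]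
  · rintro ⟨y, hy⟩
    obtain ⟨b, rfl⟩ := cohomologyClass_surjective p y
    rw [← hy, cohomologyMap_cohomologyClass hq b (map_mem_ker_of_mem_ker hq b),
      -- The cocycle b is itself a lift of q b, and dB b = 0 = i 0.
      hΔ _ b.1 0 rfl (by rw [LinearMap.mem_ker.1 b.2]; exact map_zero _), map_zero]

theorem exact_connectingMap_cohomologyMap
    (hi : ∀ p a, dB p (i p a) = i (p + 1) (dA p a)) (hq : ∀ p b, dC p (q p b) = q (p + 1) (dB p b))
    (hdB : ∀ p b, dB (p + 1) (dB p b) = 0) (hinj : ∀ p, Function.Injective (i p))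
    (hex : ∀ p, Function.Exact (i p) (q p)) (hsurj : ∀ p, Function.Surjective (q p)) {p : ℕ}
    {Δ : Cohomology dC p →ₗ[ℝ] Cohomology dA (p + 1)}
    (hΔ : ∀ (ρ : LinearMap.ker (dC p)) (η : B p) (α : LinearMap.ker (dA (p + 1))),
      q p η = ρ.1 → i (p + 1) α.1 = dB p η →
      Δ (cohomologyClass dC p ρ) = cohomologyClass dA (p + 1) α) :
    Function.Exact Δ (cohomologyMap dA dB i hi (p + 1)) := by
  intro x
  obtain ⟨a, rfl⟩ := cohomologyClass_surjective (p + 1) x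
  rw [cohomologyMap_cohomologyClass hi a (map_mem_ker_of_mem_ker hi a), cohomologyClass_eq_zero_iff]
  constructor
  · rintro ⟨b, hb⟩
    replace hb : dB p b = i (p + 1) a.1 := hb
    have hk : q p b ∈ LinearMap.ker (dC p) := by
      rw [LinearMap.mem_ker, hq, hb, (hex (p + 1)).apply_apply_eq_zero]
    exact ⟨cohomologyClass dC p ⟨q p b, hk⟩, hΔ _ b a rfl hb.symm⟩
  · rintro ⟨y, hy⟩
    obtain ⟨c, rfl⟩ := cohomologyClass_surjective p y
    obtain ⟨b, hb⟩ := hsurj p c.1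
    obtain ⟨a', ha'⟩ := (hex (p + 1) (dB p b)).1 (by rw [← hq, hb]; exact c.2)
    have hk : a' ∈ LinearMap.ker (dA (p + 1)) := by
      refine LinearMap.mem_ker.2 (hinj _ ?_)
      rw [← hi, ha', hdB, map_zero]
    rw [hΔ c b ⟨a', hk⟩ hb ha', ← sub_eq_zero, ← map_sub, cohomologyClass_eq_zero_iff] at hy
    obtain ⟨e, he⟩ : ∃ e, dA p e = a' - a.1 := hy
    -- Both a and a' represent the class, and i a' = dB b. The correction by i e removes their
    -- difference dA e.
    refine ⟨b - i p e, ?_⟩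
    change dB p (b - i p e) = i (p + 1) a.1
    rw [map_sub, hi, he, map_sub, ha', sub_sub_cancel]

end LongExactSequence

section Local

variable {E : Type*} [NormedAddCommGroup E] [NormedSpace ℝ E]
  {H : Type*} [TopologicalSpace H] {I : ModelWithCorners ℝ E H}
  {M : Type*} [TopologicalSpace M] [ChartedSpace H M]
  {N : Type*} [TopologicalSpace N] [ChartedSpace H N] {p : ℕ}

/-! ### Smoothness of forms at a point -/

/-- A form is smooth at `x` if its expression in the preferred chart at `x` is smooth there. -/
def IsSmoothAt (α : FormField I M p) (x : M) : Prop :=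
  ContDiffWithinAt ℝ ∞ (inChart α x) (range I) (extChartAt I x x)

theorem IsSmooth.isSmoothAt {α : FormField I M p} (h : IsSmooth α) (x : M) : IsSmoothAt α x :=
  h.contDiffWithinAt x (mem_extChartAt_target x)

/-- Locality of smoothness: this is what allows forms to be glued and extended by zero. -/
theorem IsSmoothAt.congr {α β : FormField I M p} {x : M} (h : IsSmoothAt α x)
    (e : ∀ᶠ y in 𝓝 x, β y = α y) : IsSmoothAt β x := by
  refine ContDiffWithinAt.congr_of_eventuallyEq_of_mem h ?_ (mem_range_self _)
  have hc : Tendsto (extChartAt I x).symm (𝓝[range I] extChartAt I x x) (𝓝 x) := by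
    have h0 := (continuousAt_extChartAt_symm (I := I) x).tendsto
    rw [extChartAt_to_inv] at h0
    exact h0.mono_left nhdsWithin_le_nhds
  filter_upwards [hc.eventually e] with z hz
  simp only [inChart, hz]

theorem isSmoothAt_zero (x : M) : IsSmoothAt (0 : FormField I M p) x :=
  (show IsSmooth (0 : FormField I M p) from (smoothForms I M p).zero_mem).isSmoothAt x

theorem IsSmoothAt.const_smul {α : FormField I M p} {x : M} (h : IsSmoothAt α x) (c : ℝ) :
    IsSmoothAt (c • α) x :=
  ContDiffWithinAt.const_smul c h

theorem IsSmoothAt.smul [IsManifold I ∞ M] {α : FormField I M p} {x : M} (h : IsSmoothAt α x)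
    {g : M → ℝ} (hg : ContMDiff I 𝓘(ℝ) ∞ g) : IsSmoothAt (fun y ↦ g y • α y) x := by
  have hg' : ContDiffWithinAt ℝ ∞ (g ∘ (extChartAt I x).symm) (range I) (extChartAt I x x) := by
    rw [← contMDiffWithinAt_iff_contDiffWithinAt]
    exact (hg _).comp_contMDiffWithinAt _
      (contMDiffWithinAt_extChartAt_symm_range x (mem_extChartAt_target x))
  exact ContDiffWithinAt.smul hg' h

section Pull

variable [IsManifold I ∞ M] [IsManifold I ∞ N]

/-- Smoothness of α is assumed at one point only, in the preferred chart there, while the chart at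
x₀ is arbitrary. With f = id this becomes independence of the chart. -/
theorem contDiffWithinAt_inChart_pull {α : FormField I M p} {f : N → M} (hf : ContMDiff I I ∞ f)
    (x₀ : N) {y : E} (hy : y ∈ (extChartAt I x₀).target)
    (h : IsSmoothAt α (f ((extChartAt I x₀).symm y))) :
    ContDiffWithinAt ℝ ∞ (inChart (pull f α) x₀) (range I) y := by
  have hfy := mem_extChartAt_source (I := I) (f ((extChartAt I x₀).symm y))
  have hyr := extChartAt_target_subset_range x₀ hy
  have ht := contDiffWithinAt_transition hf x₀ _ hy hfy
  have e := inChart_pull_eventuallyEq hf α x₀ _ hy hfy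
  refine ContDiffWithinAt.congr_of_eventuallyEq ?_ e (e.self_of_nhdsWithin hyr)
  refine contDiffWithinAt_compCLM ?_ ?_
  · have h' : ContDiffWithinAt ℝ ∞ (inChart α (f ((extChartAt I x₀).symm y))) (range I)
        ((extChartAt I (f ((extChartAt I x₀).symm y)) ∘ f ∘ (extChartAt I x₀).symm) y) := h
    exact h'.comp y ht (mapsTo_transition x₀ _)
  · exact ht.fderivWithin_right I.uniqueDiffOn (by simp) hyr

theorem IsSmoothAt.pull {α : FormField I M p} {f : N → M} (hf : ContMDiff I I ∞ f) {x : N}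
    (h : IsSmoothAt α (f x)) : IsSmoothAt (pull f α) x :=
  contDiffWithinAt_inChart_pull hf x (mem_extChartAt_target x) (by rwa [extChartAt_to_inv])

theorem isSmooth_of_isSmoothAt {α : FormField I M p} (h : ∀ x, IsSmoothAt α x) : IsSmooth α := by
  intro x₀ y hy
  have key := contDiffWithinAt_inChart_pull contMDiff_id x₀ hy (h _)
  rw [pull_id] at key
  exact key.mono (extChartAt_target_subset_range x₀)

end Pull

/-! ### Restriction to open subsets and extension by zero -/

/-- The chart of U at u is the restriction of the chart of M at u, so the inclusion reads as the
identity in these charts. -/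
theorem extChartAt_coe_transition_eventuallyEq (U : Opens M) (u : U) :
    extChartAt I (u : M) ∘ Subtype.val ∘ (extChartAt I u).symm
      =ᶠ[𝓝[range I] extChartAt I u u] id := by
  filter_upwards [extChartAt_target_mem_nhdsWithin (I := I) u] with z hz
  exact (extChartAt I u).right_inv hz

theorem mfderiv_subtypeVal_apply (U : Opens M) (u : U) (v : E) :
    mfderiv I I (Subtype.val : U → M) u v = v := by
  have hd : MDifferentiableAt I I (Subtype.val : U → M) u :=
    (contMDiff_subtype_val (n := ∞) u).mdifferentiableAt (by simp)
  have e : fderivWithin ℝ (writtenInExtChartAt I I u (Subtype.val : U → M)) (range I)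
      (extChartAt I u u) = ContinuousLinearMap.id ℝ E :=
    (Filter.EventuallyEq.fderivWithin_eq_of_mem (extChartAt_coe_transition_eventuallyEq U u)
      (mem_range_self _)).trans (fderivWithin_id (I.uniqueDiffOn _ (mem_range_self _)))
  exact congrArg (fun L : E →L[ℝ] E ↦ L v) (hd.mfderiv.trans e)

/-- Both tangent spaces are E by definition, and the derivative of the inclusion is the identity of
E. -/
theorem pull_subtypeVal_apply (U : Opens M) (α : FormField I M p) (u : U) :
    pull (Subtype.val : U → M) α u = α (u : M) := by
  ext v
  exact FormField.apply_congr α rfl (funext fun i ↦ mfderiv_subtypeVal_apply (E := E) U u (v i))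

open Classical in
/-- The extension by zero of a form on an open subset. -/
def extendZero {U : Opens M} (α : FormField I U p) : FormField I M p := fun x ↦
  if h : x ∈ U then α ⟨x, h⟩ else 0

theorem extendZero_of_notMem {U : Opens M} (α : FormField I U p) {x : M} (h : x ∉ U) :
    extendZero α x = 0 :=
  dif_neg h

theorem pull_extendZero {U : Opens M} (α : FormField I U p) :
    pull (Subtype.val : U → M) (extendZero α) = α := by
  funext u
  exact (pull_subtypeVal_apply U _ u).trans (dif_pos u.2)

variable [IsManifold I ∞ M]

theorem inChart_pull_subtypeVal_eventuallyEq (U : Opens M) (α : FormField I M p) (u : U) :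
    inChart (pull (Subtype.val : U → M) α) u =ᶠ[𝓝[range I] extChartAt I u u]
      inChart α (u : M) := by
  have hu := mem_extChartAt_target (I := I) u
  -- The derivative at z depends on the transition map near z, so the equality is needed in a
  -- neighbourhood of each nearby z.
  have ht := eventually_eventually_nhdsWithin.2 (extChartAt_coe_transition_eventuallyEq (I := I) U u)
  have hmem : Subtype.val ((extChartAt I u).symm (extChartAt I u u)) ∈
      (extChartAt I (u : M)).source := by
    rw [extChartAt_to_inv]
    exact mem_extChartAt_source _
  filter_upwards [inChart_pull_eventuallyEq contMDiff_subtype_val α u (u : M) hu hmem, ht,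
    self_mem_nhdsWithin] with z hz hz' hzr
  have hz0 := EventuallyEq.eq_of_nhdsWithin hz' hzr
  rw [hz, Filter.EventuallyEq.fderivWithin_eq_of_mem hz' hzr, hz0,
    fderivWithin_id (I.uniqueDiffOn _ hzr)]
  rfl

theorem isSmoothAt_pull_subtypeVal_iff (U : Opens M) (α : FormField I M p) (u : U) :
    IsSmoothAt (pull (Subtype.val : U → M) α) u ↔ IsSmoothAt α (u : M) :=
  have e := inChart_pull_subtypeVal_eventuallyEq U α u
  ⟨fun h ↦ h.congr_of_eventuallyEq_of_mem e.symm (mem_range_self _),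
    fun h ↦ h.congr_of_eventuallyEq_of_mem e (mem_range_self _)⟩

theorem IsSmooth.isSmoothAt_extendZero {U : Opens M} {α : FormField I U p} (h : IsSmooth α) {x : M}
    (hx : x ∈ U) : IsSmoothAt (extendZero α) x := by
  refine (isSmoothAt_pull_subtypeVal_iff U (extendZero α) ⟨x, hx⟩).1 ?_
  rw [pull_extendZero]
  exact h.isSmoothAt _

end Local

section Involution

/-! ### The cover by V and τ(V) -/

theorem mem_image_iff_of_involutive {X : Type*} {f : X → X} (hf : Function.Involutive f) {s : Set X}
    {x : X} : x ∈ f '' s ↔ f x ∈ s := by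
  rw [image_eq_preimage_of_inverse hf.leftInverse hf.rightInverse, mem_preimage]

variable {E : Type*} [NormedAddCommGroup E] [NormedSpace ℝ E]
  {H : Type*} [TopologicalSpace H] {I : ModelWithCorners ℝ E H}
  {M : Type*} [TopologicalSpace M] [ChartedSpace H M]
  {τ : C^∞⟮I, M; I, M⟯} {V : Opens M} {p : ℕ}

theorem mem_or_apply_mem_of_cover (hτ : Function.Involutive τ)
    (hV : (V : Set M) ∪ τ '' (V : Set M) = univ) (x : M) : x ∈ V ∨ τ x ∈ V := by
  have h : x ∈ (V : Set M) ∪ τ '' (V : Set M) := hV ▸ mem_univ x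
  exact h.imp id (mem_image_iff_of_involutive hτ).1

/-! ### The short exact sequence of forms and symmetric partitions of unity -/

theorem units_smul_smul_self {F : Type*} [AddCommGroup F] [Module ℝ F] (ε : ℤˣ) (a : F) :
    ((ε : ℤ) : ℝ) • ((ε : ℤ) : ℝ) • a = a := by
  rw [smul_smul, show ((ε : ℤ) : ℝ) * ((ε : ℤ) : ℝ) = 1 by exact_mod_cast Int.units_coe_mul_self ε,
    one_smul]

theorem add_units_smul_eq_zero_iff {F : Type*} [AddCommGroup F] [Module ℝ F] (ε : ℤˣ) {a b : F} :
    a + ((ε : ℤ) : ℝ) • b = 0 ↔ (((-ε : ℤˣ) : ℤ) : ℝ) • b = a := by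
  rw [Units.val_neg, Int.cast_neg, neg_smul, add_eq_zero_iff_eq_neg, eq_comm]

theorem mem_overlap_iff (hτ : Function.Involutive τ) {x : M} :
    x ∈ overlap τ hτ V ↔ x ∈ V ∧ τ x ∈ V :=
  and_congr Iff.rfl (mem_image_iff_of_involutive hτ)

theorem pull_pull_of_involutive (hτ : Function.Involutive τ) (α : FormField I M p) :
    pull τ (pull τ α) = α := by
  rw [pull_comp τ.contMDiff τ.contMDiff, hτ.comp_self, pull_id]

theorem pull_apply_congr {f : M → M} {α β : FormField I M p} {x : M} (h : α (f x) = β (f x)) :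
    pull f α x = pull f β x := by
  simp only [pull, h]

theorem pull_overlapIncl_pull (hτ : Function.Involutive τ) (α : FormField I M p) :
    pull (overlapIncl τ hτ V) (pull (Subtype.val : V → M) α) =
      pull (Subtype.val : overlap τ hτ V → M) α :=
  pull_comp contMDiff_subtype_val (overlapIncl τ hτ V).contMDiff α

theorem pull_overlapInvol_pull (hτ : Function.Involutive τ) (α : FormField I M p) :
    pull (overlapInvol τ hτ V) (pull (Subtype.val : overlap τ hτ V → M) α) =
      pull (Subtype.val : overlap τ hτ V → M) (pull τ α) := by
  rw [pull_comp contMDiff_subtype_val (overlapInvol τ hτ V).contMDiff,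
    pull_comp τ.contMDiff contMDiff_subtype_val]
  rfl

variable [IsManifold I ∞ M]

/-- Moves the computation of (1 ± τ^*)j^*η from U to M, where τ acts on all forms. The form α need
not be smooth, so the extension of η by zero is allowed. -/
theorem coe_symmetrize_eq_pull (hτ : Function.Involutive τ) (ε : ℤˣ) {η : DForm I V p}
    {α : FormField I M p} (h : η.1 = pull (Subtype.val : V → M) α) :
    (symmetrize τ hτ V ε p η).1.1 =
      pull (Subtype.val : overlap τ hτ V → M) (α + ((ε : ℤ) : ℝ) • pull τ α) := by
  change pull (overlapIncl τ hτ V) η.1 + ((ε : ℤ) : ℝ) •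
    pull (overlapInvol τ hτ V) (pull (overlapIncl τ hτ V) η.1) = _
  rw [h, pull_overlapIncl_pull, pull_overlapInvol_pull]
  rfl

theorem exists_isSymmetricPartition [FiniteDimensional ℝ E] [T2Space M] [SecondCountableTopology M]
    (hτ : Function.Involutive τ) (hV : (V : Set M) ∪ τ '' (V : Set M) = univ) :
    ∃ f : C^∞⟮I, M; 𝓘(ℝ), ℝ⟯, IsSymmetricPartition τ V f := by
  -- Together with second countability this gives the σ-compactness needed for partitions of unity.
  have : LocallyCompactSpace M := Manifold.locallyCompact_of_finiteDimensional I
  have hpre : τ '' (V : Set M) = τ ⁻¹' (V : Set M) := ext fun _ ↦ mem_image_iff_of_involutive hτ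
  have hτc : Continuous τ := τ.contMDiff.continuous
  obtain ⟨g, hg⟩ := SmoothPartitionOfUnity.exists_isSubordinate I (isClosed_univ (X := M))
    (fun b : Bool ↦ cond b (V : Set M) (τ ⁻¹' (V : Set M)))
    (by rintro (_ | _); exacts [V.isOpen.preimage hτc, V.isOpen])
    (fun x _ ↦ by
      rcases mem_or_apply_mem_of_cover hτ hV x with h | h
      exacts [mem_iUnion.2 ⟨true, h⟩, mem_iUnion.2 ⟨false, h⟩])
  have hsum : ∀ x, g true x + g false x = 1 := fun x ↦ by
    rw [← g.sum_eq_one (mem_univ x), finsum_eq_sum_of_fintype, Fintype.sum_bool]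
  -- For a partition of unity (g, h) subordinate to (V, τ(V)), the average f = (g + τ^*h)/2 is
  -- supported in V, and f + τ^*f = (g + h + τ^*(g + h))/2 = 1.
  have hf : ContMDiff I 𝓘(ℝ) ∞ fun x ↦ (2⁻¹ : ℝ) * (g true x + g false (τ x)) :=
    contMDiff_const.mul ((g true).contMDiff.add ((g false).contMDiff.comp τ.contMDiff))
  have hsub : tsupport (fun x ↦ (2⁻¹ : ℝ) * (g true x + g false (τ x))) ⊆ (V : Set M) := by
    have h1 : tsupport (fun x ↦ g false (τ x)) ⊆ (V : Set M) := by
      refine (tsupport_comp_subset_preimage (g false) hτc).trans fun x hx ↦ ?_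
      have h : τ (τ x) ∈ (V : Set M) := hg false hx
      rwa [hτ x] at h
    refine ((closure_mono (Function.support_mul_subset_right _ _)).trans
      (tsupport_add (g true) (fun x ↦ g false (τ x)))).trans (union_subset (hg true) h1)
  refine ⟨⟨_, hf⟩, ⟨fun x ↦ ?_, hsub, ?_, fun x ↦ ?_⟩⟩
  · exact mul_nonneg (by norm_num) (add_nonneg (g.nonneg _ _) (g.nonneg _ _))
  · rw [hpre]
    exact (tsupport_comp_subset_preimage _ hτc).trans (preimage_mono hsub)
  · change (2⁻¹ : ℝ) * (g true x + g false (τ x)) +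
      2⁻¹ * (g true (τ x) + g false (τ (τ x))) = 1
    rw [hτ x]
    linarith [hsum x, hsum (τ x)]

/-- If x lies outside V, then τ x lies in V, and α at x equals, up to sign, τ^*α at x, which depends
only on α at τ x. -/
theorem restrictForm_injective (hτ : Function.Involutive τ)
    (hV : (V : Set M) ∪ τ '' (V : Set M) = univ) (ε : ℤˣ) (p : ℕ) :
    Function.Injective (restrictForm τ V ε p) := by
  refine (injective_iff_map_eq_zero _).2 fun α hα ↦ Subtype.ext (Subtype.ext (funext fun x ↦ ?_))
  have h0 : ∀ y : M, y ∈ V → α.1.1 y = 0 := fun y hy ↦ by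
    have e := congrFun (congrArg Subtype.val hα) (⟨y, hy⟩ : V)
    exact (pull_subtypeVal_apply V α.1.1 ⟨y, hy⟩).symm.trans e
  have hs : pull τ α.1.1 = ((ε : ℤ) : ℝ) • α.1.1 := congrArg Subtype.val α.2
  rcases mem_or_apply_mem_of_cover hτ hV x with h | h
  · exact h0 x h
  · have e1 : pull τ α.1.1 x = 0 := pull_apply_congr (β := 0) (h0 _ h)
    have e2 : ((ε : ℤ) : ℝ) • α.1.1 x = 0 := (congrFun hs x).symm.trans e1
    change α.1.1 x = 0
    rw [← units_smul_smul_self ε (α.1.1 x), e2, smul_zero]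

theorem exact_restrictForm_symmetrize (hτ : Function.Involutive τ)
    (hV : (V : Set M) ∪ τ '' (V : Set M) = univ) (ε : ℤˣ) (p : ℕ) :
    Function.Exact (restrictForm τ V (-ε) p) (symmetrize τ hτ V ε p) := by
  classical
  intro η
  constructor
  · intro h
    set β : FormField I M p := extendZero η.1
    have hβη : η.1 = pull (Subtype.val : V → M) β := (pull_extendZero η.1).symm
    have hβs : ∀ x ∈ V, IsSmoothAt β x := fun x hx ↦
      IsSmooth.isSmoothAt_extendZero (α := η.1) η.2 hx
    -- This is what the sign condition forces on τ(V). It is smooth there, as β is smooth on V, and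
    -- the kernel condition on η says that β and γ agree on U.
    let γ : FormField I M p := (((-ε : ℤˣ) : ℤ) : ℝ) • pull τ β
    have hU : ∀ x, x ∈ V → τ x ∈ V → γ x = β x := by
      intro x hxV hxτ
      have hx : x ∈ overlap τ hτ V := (mem_overlap_iff hτ).2 ⟨hxV, hxτ⟩
      have e0 : pull (Subtype.val : overlap τ hτ V → M) (β + ((ε : ℤ) : ℝ) • pull τ β) = 0 :=
        (coe_symmetrize_eq_pull hτ ε hβη).symm.trans (congrArg (fun s ↦ s.1.1) h)
      have e1 : β x + ((ε : ℤ) : ℝ) • pull τ β x = 0 :=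
        (pull_subtypeVal_apply _ _ (⟨x, hx⟩ : overlap τ hτ V)).symm.trans (congrFun e0 ⟨x, hx⟩)
      exact (add_units_smul_eq_zero_iff ε).1 e1
    let α : FormField I M p := fun x ↦ if x ∈ V then β x else γ x
    have hαV : ∀ x ∈ V, α x = β x := fun x hx ↦ if_pos hx
    have hατ : ∀ x, τ x ∈ V → α x = γ x := fun x hx ↦ by
      by_cases hxV : x ∈ V
      · rw [hαV x hxV, hU x hxV hx]
      · exact if_neg hxV
    have hαs : IsSmooth α := by
      refine isSmooth_of_isSmoothAt fun x ↦ ?_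
      rcases mem_or_apply_mem_of_cover hτ hV x with hx | hx
      · refine (hβs x hx).congr ?_
        filter_upwards [V.isOpen.mem_nhds hx] with y hy using hαV y hy
      · refine (((hβs _ hx).pull τ.contMDiff).const_smul (((-ε : ℤˣ) : ℤ) : ℝ)).congr ?_
        filter_upwards [(V.isOpen.preimage τ.contMDiff.continuous).mem_nhds hx] with y hy
          using hατ y hy
    -- Pulling back by τ exchanges the descriptions of α on V and on τ(V), because τ^*τ^*β = β and
    -- the sign squares to 1.
    have hατs : pull τ α = (((-ε : ℤˣ) : ℤ) : ℝ) • α := by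
      funext x
      rcases mem_or_apply_mem_of_cover hτ hV x with hx | hx
      · have hx' : τ (τ x) ∈ V := by rwa [hτ x]
        have e : pull τ γ x = (((-ε : ℤˣ) : ℤ) : ℝ) • pull τ (pull τ β) x := rfl
        rw [pull_pull_of_involutive hτ] at e
        exact (pull_apply_congr (hατ _ hx')).trans
          (e.trans (congrArg ((((-ε : ℤˣ) : ℤ) : ℝ) • ·) (hαV x hx).symm))
      · exact (pull_apply_congr (hαV _ hx)).trans ((units_smul_smul_self (-ε) (pull τ β x)).symm.trans
          (congrArg ((((-ε : ℤˣ) : ℤ) : ℝ) • ·) (hατ x hx).symm))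
    refine ⟨⟨⟨α, hαs⟩, Subtype.ext hατs⟩, Subtype.ext ?_⟩
    rw [hβη]
    funext v
    exact (pull_subtypeVal_apply V α v).trans
      ((hαV v v.2).trans (pull_subtypeVal_apply V β v).symm)
  · rintro ⟨α, rfl⟩
    refine Subtype.ext (Subtype.ext ?_)
    have hs : pull τ α.1.1 = (((-ε : ℤˣ) : ℤ) : ℝ) • α.1.1 := congrArg Subtype.val α.2
    refine (coe_symmetrize_eq_pull hτ ε (α := α.1.1) rfl).trans ?_
    have key : ∀ a : FormField I M p, a + ((ε : ℤ) : ℝ) • (((-ε : ℤˣ) : ℤ) : ℝ) • a = 0 := fun a ↦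
      (add_units_smul_eq_zero_iff ε).2 (units_smul_smul_self (-ε) a)
    rw [hs]
    refine (congrArg _ (key α.1.1)).trans ?_
    rfl

/-- The extension by zero of (τ^*f)ρ is smooth on V because the support of τ^*f lies in τ(V), so it
misses V \ U. The weight is τ^*f and not f because the support of f may accumulate at V \ U. -/
theorem IsSymmetricPartition.exists_preimage (hτ : Function.Involutive τ)
    {f : C^∞⟮I, M; 𝓘(ℝ), ℝ⟯} (hf : IsSymmetricPartition τ V f) (ε : ℤˣ) (p : ℕ)
    (ρ : signedForms (overlapInvol τ hτ V) ε p) :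
    ∃ η : DForm I V p,
      (∀ u : overlap τ hτ V, (pullback (overlapIncl τ hτ V) p η).1 u = f (τ u) • ρ.1.1 u) ∧
      (∀ v : V, (v : M) ∉ overlap τ hτ V → η.1 v = 0) ∧ symmetrize τ hτ V ε p η = ρ := by
  set β : FormField I M p := extendZero ρ.1.1 with hβ
  have hβρ : pull (Subtype.val : overlap τ hτ V → M) β = ρ.1.1 := pull_extendZero ρ.1.1
  let γ : FormField I M p := fun x ↦ f (τ x) • β x
  have hγ : ∀ x ∈ V, IsSmoothAt γ x := fun x hx ↦ by
    by_cases hxU : x ∈ overlap τ hτ V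
    · exact (IsSmooth.isSmoothAt_extendZero (α := ρ.1.1) ρ.1.2 hxU).smul
        (f.contMDiff.comp τ.contMDiff)
    · have hx' : x ∉ tsupport (f ∘ τ) := fun h ↦ hxU ⟨hx, hf.tsupport_comp_subset h⟩
      refine (isSmoothAt_zero x).congr ?_
      filter_upwards [(isClosed_tsupport _).isOpen_compl.mem_nhds hx'] with y hy
      have hy0 : (f ∘ τ) y = 0 := image_eq_zero_of_notMem_tsupport hy
      exact (congrArg (· • β y) hy0).trans (zero_smul ℝ (β y))
  let η : DForm I V p := ⟨pull (Subtype.val : V → M) γ,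
    isSmooth_of_isSmoothAt fun v ↦ (isSmoothAt_pull_subtypeVal_iff V γ v).2 (hγ v v.2)⟩
  have hηγ : η.1 = pull (Subtype.val : V → M) γ := rfl
  refine ⟨η, fun u ↦ ?_, fun v hv ↦ ?_, Subtype.ext (Subtype.ext ?_)⟩
  · have e := congrFun (pull_overlapIncl_pull (V := V) hτ γ) u
    refine (e.trans (pull_subtypeVal_apply _ γ u)).trans ?_
    rw [← hβρ]
    exact congrArg (f (τ u) • ·) (pull_subtypeVal_apply _ β u).symm
  · refine (pull_subtypeVal_apply V γ v).trans ?_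
    simp only [γ, hβ, extendZero_of_notMem _ hv, smul_zero]
    rfl
  · rw [coe_symmetrize_eq_pull hτ ε hηγ]
    have hs : pull (overlapInvol τ hτ V) ρ.1.1 = ((ε : ℤ) : ℝ) • ρ.1.1 := congrArg Subtype.val ρ.2
    rw [← hβρ, pull_overlapInvol_pull] at hs
    funext u
    have hsu : pull τ β (u : M) = ((ε : ℤ) : ℝ) • β u := by
      have e := congrFun hs u
      rw [pull_subtypeVal_apply] at e
      exact e.trans (congrArg (((ε : ℤ) : ℝ) • ·) (pull_subtypeVal_apply _ β u))
    -- Applying τ^* turns the weight τ^*f back into f. With τ^*ρ = ±ρ, the two terms add up to (τ^*f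
    -- + f)ρ = ρ.
    have hγu : pull τ γ (u : M) = f u • pull τ β u := by
      have e : f (τ (τ u)) = f u := congrArg f (hτ u)
      simp only [pull, γ, e]
      rfl
    rw [← hβρ, pull_subtypeVal_apply, pull_subtypeVal_apply]
    change f (τ u) • β u + ((ε : ℤ) : ℝ) • pull τ γ u = β u
    rw [hγu, hsu, smul_comm]
    refine (congrArg (f (τ u) • β u + f u • ·) (units_smul_smul_self ε (β u))).trans ?_
    rw [← add_smul, add_comm, hf.add_eq_one, one_smul]

end Involution

end InvolutiveDeRham

end

/-! ### The Mayer–Vietoris theorem -/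

open InvolutiveDeRham in
theorem mainTheorem2
    {E : Type*} [NormedAddCommGroup E] [NormedSpace ℝ E] [FiniteDimensional ℝ E]
    {H : Type*} [TopologicalSpace H] {I : ModelWithCorners ℝ E H}
    {X : Type*} [TopologicalSpace X] [ChartedSpace H X] [IsManifold I ∞ X]
    [T2Space X] [SecondCountableTopology X]
    (τ : C^∞⟮I, X; I, X⟯) (hτ : Function.Involutive τ)
    (V : Opens X) (hV : (V : Set X) ∪ τ '' (V : Set X) = univ) (ε : ℤˣ) :
    -- a symmetric partition of unity exists
    (∃ f : C^∞⟮I, X; 𝓘(ℝ), ℝ⟯, IsSymmetricPartition τ V f) ∧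
    -- the short exact sequence of complexes of forms
    (∀ p : ℕ, Function.Injective (restrictForm τ V (-ε) p) ∧
      Function.Exact (restrictForm τ V (-ε) p) (symmetrize τ hτ V ε p) ∧
      Function.Surjective (symmetrize τ hτ V ε p) ∧
      (∀ α, d I V p (restrictForm τ V (-ε) p α) =
        restrictForm τ V (-ε) (p + 1) (signedD τ (-ε) p α)) ∧
      (∀ α, signedD (overlapInvol τ hτ V) ε p (symmetrize τ hτ V ε p α) =
        symmetrize τ hτ V ε (p + 1) (d I V p α))) ∧
    -- every symmetric partition of unity gives preimages under `(1 ± τ^*) j^*`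
    (∀ f : C^∞⟮I, X; 𝓘(ℝ), ℝ⟯, IsSymmetricPartition τ V f →
      ∀ (p : ℕ) (ρ : signedForms (overlapInvol τ hτ V) ε p), ∃ η : DForm I V p,
        (∀ u : overlap τ hτ V,
          (pullback (overlapIncl τ hτ V) p η).1 u = f (τ u) • ρ.1.1 u) ∧
        (∀ v : V, (v : X) ∉ overlap τ hτ V → η.1 v = 0) ∧
        symmetrize τ hτ V ε p η = ρ) ∧
    -- the long exact sequence, with the connecting maps of the short exact sequence
    ∃ Δ : ∀ p : ℕ, HdRSigned (overlapInvol τ hτ V) ε p →ₗ[ℝ] HdRSigned τ (-ε) (p + 1),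
      (∀ (p : ℕ) (ρ : LinearMap.ker (signedD (overlapInvol τ hτ V) ε p))
        (η : DForm I V p) (α : LinearMap.ker (signedD τ (-ε) (p + 1))),
        symmetrize τ hτ V ε p η = ρ.1 →
        restrictForm τ V (-ε) (p + 1) α.1 = d I V p η →
        Δ p (cohomologyClass _ p ρ) = cohomologyClass _ (p + 1) α) ∧
      Function.Injective (restrictCoh τ V (-ε) 0) ∧
      ∀ p : ℕ,
        Function.Exact (restrictCoh τ V (-ε) p) (symmetrizeCoh τ hτ V ε p) ∧
        Function.Exact (symmetrizeCoh τ hτ V ε p) (Δ p) ∧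
        Function.Exact (Δ p) (restrictCoh τ V (-ε) (p + 1)) := by
  have hinj := restrictForm_injective (I := I) hτ hV (-ε)
  have hex := exact_restrictForm_symmetrize (I := I) hτ hV ε
  obtain ⟨f, hf⟩ := exists_isSymmetricPartition (I := I) hτ hV
  have hsurj : ∀ p, Function.Surjective (symmetrize τ hτ V ε p) := fun p ρ ↦
    (hf.exists_preimage hτ ε p ρ).imp fun _ h ↦ h.2.2
  have hi := d_restrictForm τ V (-ε)
  have hq := d_symmetrize τ hτ V ε
  have hd := d_d (I := I) (M := V)
  refine ⟨⟨f, hf⟩, fun p ↦ ⟨hinj p, hex p, hsurj p, hi p, hq p⟩,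
    fun g hg p ρ ↦ hg.exists_preimage hτ ε p ρ, ?_⟩
  choose Δ hΔ using exists_connectingMap hi hq hd hinj hex hsurj
  exact ⟨Δ, hΔ, cohomologyMap_zero_injective hi (hinj 0), fun p ↦
    ⟨exact_cohomologyMap hi hq hd hinj hex hsurj p,
      exact_cohomologyMap_connectingMap hi hq hd hinj hex hsurj (hΔ p),
      exact_connectingMap_cohomologyMap hi hq hd hinj hex hsurj (hΔ p)⟩⟩
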